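/- **Setting.** Let $1\le K\le M$ and $d\ge0$ be integers. Arm $m\in[M]$ produces i.i.d. samples from the Gaussian law $N(\mu_m, I_d)$ on $\mathbb R^d$, independently over the arms; $\mu=(\mu_1,\dots,\mu_M)$ is the problem instance. Let $\mathcal C$ be a map that assigns to every $\lambda\in(\mathbb R^{d})^M$ a cluster index vector $\mathcal C(\lambda)\in[K]^M$ output by single-linkage (SLINK) clustering of $\lambda_1,\dots,\lambda_M$ into $K$ clusters: start from singletons and repeatedly merge two clusters at minimum distance, where the distance of two clusters is $\min\|\lambda_i-\lambda_j\|^2$ over $i$ in the one and $j$ in the other, until $K$ clusters remain (ties and labels are resolved by an arbitrary rule). Write $c\sim c'$ if $c=\sigma\circ c'$ for a permutation $\sigma$ of $[K]$. The instance $\mu$ is assumed to be separated, $d_{\rm INTRA}<d_{\rm INTER}$ for the clusters $D_1,\dots,D_K$ given by $\mathcal C(\mu)$, where $$d_{\rm INTER}=\min_{p\ne q}\ \min_{i\in D_p,\,j\in D_q}\|\mu_i-\mu_j\|^2,\qquad d_{\rm INTRA}=\max_{k}\ \max_{\emptyset\ne S\subsetneq D_k}\ \min_{i\in S,\,j\in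 D_k\setminus S}\|\mu_i-\mu_j\|^2$$ ($\min\emptyset=\infty$, $\max\emptyset=-\infty$). Let $\mathcal P_M$ be the probability simplex in $\mathbb R^M$, and $$\mathrm{Alt}(\mu)=\{\lambda:\mathcal C(\lambda)\not\sim\mathcal C(\mu)\},\qquad \psi(w,\mu)=\inf_{\lambda\in \mathrm{Alt}(\mu)}\tfrac12\sum_{m=1}^M w_m\|\lambda_m-\mu_m\|^2,\qquad T^*(\mu)^{-1}=\sup_{w\in\mathcal P_M}\psi(w,\mu)$$ (with values in $[0,\infty]$, $\inf\emptyset=\infty$, $\infty^{-1}=0$). **ATBOC.** Let $A_t$ be the arm sampled at time $t\ge1$, $N_m(t)$ the number of samples of arm $m$ up to time $t$, $\hat\mu_m(t)$ the empirical mean of these samples ($0$ if there are none), and for $t\ge 1$ let $w(t)\in\operatorname{argmax}_{w\in\mathcal P_M}\psi(w,\hat\mu(t))$ be any maximizer. The first arm $A_1$ is arbitrary. For $t\ge1$, if $\min_m N_m(t)<\sqrt{t/M}$, then $A_{t+1}\in\operatorname{argmin}_{m}N_m(t)$; otherwise $$A_{t+1}\in\operatorname{argmin}_{m}\Big[\tfrac{N_m(t)}t-\tfrac1t\sum_{s=1}^t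 w_m(s)\Big]\quad\text{over all } m \text{ with } \sum_{s=1}^t w_m(s)\ne0 .$$ Ties are broken arbitrarily. For $\delta\in(0,1)$ the algorithm stops at $$\tau_\delta=\inf\Big\{t\ge1:\ t\,\psi\big(N(t)/t,\hat\mu(t)\big)\ \ge\ 2\log\Big(\tfrac1\delta\sqrt{\textstyle\prod_{m=1}^M(N_m(t)+1)^d}\Big)\Big\}.$$ **Theorem.** For any such instance $\mu$, almost surely $$\limsup_{\delta\to0}\frac{\tau_\delta}{\log(1/\delta)}\le 2\,T^*(\mu).$$ -/

import Mathlib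

open Set Filter Topology MeasureTheory ProbabilityTheory
open scoped ENNReal

noncomputable section

namespace BanditClustering

/-- A collection of `M` mean vectors in `ℝ^d`, one for each arm. -/
abbrev Means (d M : ℕ) : Type := Fin M → EuclideanSpace ℝ (Fin d)

variable {d M K : ℕ}

/-! ### Cluster distances -/

/-- The distance `‖x_i - x_j‖²` between arms `i` and `j`. -/
def armDist (x : Means d M) (i j : Fin M) : ℝ := ‖x i - x j‖ ^ 2

/-- The smallest distance between an arm of `S` and an arm of `T` (`⊤` if one of them is empty). -/
def setDist (x : Means d M) (S T : Finset (Fin M)) : EReal :=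
  ⨅ i ∈ S, ⨅ j ∈ T, (armDist x i j : EReal)

/-- The set of arms whose cluster index is `k`. -/
def clusterOf (c : Fin M → Fin K) (k : Fin K) : Finset (Fin M) :=
  Finset.univ.filter fun m => c m = k

/-- The minimum inter-cluster distance (`⊤` if there is just one cluster). -/
def dInter (x : Means d M) (c : Fin M → Fin K) : EReal :=
  ⨅ (p : Fin K) (q : Fin K) (_ : p ≠ q), setDist x (clusterOf c p) (clusterOf c q)

/-- The maximum neighbour distance inside cluster `k`: the maximum, over all ways to split the
cluster into two nonempty parts, of the distance between the parts (`⊥` for a one-arm cluster). -/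
def clusterIntra (x : Means d M) (c : Fin M → Fin K) (k : Fin K) : EReal :=
  ⨆ (S : Finset (Fin M)) (_ : S ⊆ clusterOf c k ∧ S ≠ ∅ ∧ S ≠ clusterOf c k),
    setDist x S (clusterOf c k \ S)

/-- The overall maximum intra-cluster neighbour distance. -/
def dIntra (x : Means d M) (c : Fin M → Fin K) : EReal :=
  ⨆ k : Fin K, clusterIntra x c k

/-! ### Single-linkage clustering -/

/-- The partitions of the set of arms that single-linkage clustering can pass through, started
from the partition into singletons. Each step merges two distinct clusters at minimum distance;
ties may be broken in any way. -/
inductive SlinkReaches (x : Means d M) : Finset (Finset (Fin M)) → Prop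
  | start : SlinkReaches x (Finset.univ.image fun m => {m})
  | merge (Q : Finset (Finset (Fin M))) (S T : Finset (Fin M)) (hQ : SlinkReaches x Q)
      (hS : S ∈ Q) (hT : T ∈ Q) (hST : S ≠ T)
      (hmin : ∀ S' ∈ Q, ∀ T' ∈ Q, S' ≠ T' → setDist x S T ≤ setDist x S' T') :
      SlinkReaches x (insert (S ∪ T) ((Q.erase S).erase T))

/-- `c` is a cluster index vector that single-linkage clustering into `K` clusters can output:
its level sets are the clusters of a reachable partition with exactly `K` clusters. -/
def IsSlinkOutput (x : Means d M) (c : Fin M → Fin K) : Prop :=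
  ∃ Q : Finset (Finset (Fin M)), SlinkReaches x Q ∧ Q.card = K ∧
    ∀ i j : Fin M, c i = c j ↔ ∃ S ∈ Q, i ∈ S ∧ j ∈ S

/-- `C` is a single-linkage clustering map, with an arbitrary rule for breaking ties and for
numbering the clusters. -/
def IsSlinkMap (C : Means d M → Fin M → Fin K) : Prop :=
  ∀ x : Means d M, IsSlinkOutput x (C x)

/-- Two cluster index vectors are equivalent if they differ by a permutation of the labels. -/
def ClusterEquiv (c₁ c₂ : Fin M → Fin K) : Prop :=
  ∃ σ : Equiv.Perm (Fin K), ∀ m, c₁ m = σ (c₂ m)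

/-! ### The max-min problem of the lower bound -/

/-- The set of alternative instances, those that are clustered differently from `μ`. -/
def Alt (C : Means d M → Fin M → Fin K) (μ : Means d M) : Set (Means d M) :=
  {l | ¬ ClusterEquiv (C l) (C μ)}

/-- The inner infimum `ψ(w, μ)`, for `w` with nonnegative entries; it is `∞` if there is no
alternative instance. -/
def psi (C : Means d M → Fin M → Fin K) (w : Fin M → ℝ) (μ : Means d M) : ℝ≥0∞ :=
  ⨅ l ∈ Alt C μ, ENNReal.ofReal ((1 / 2) * ∑ m, w m * ‖l m - μ m‖ ^ 2)

/-- The characteristic time `T*(μ)`, the inverse of `sup_w ψ(w, μ)` over the simplex. -/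
def Tstar (C : Means d M → Fin M → Fin K) (μ : Means d M) : ℝ≥0∞ :=
  (⨆ w ∈ stdSimplex ℝ (Fin M), psi C w μ)⁻¹

/-- The set `S*(μ)` of maximizers of `ψ(·, μ)` over the simplex. -/
def optProportions (C : Means d M → Fin M → Fin K) (μ : Means d M) : Set (Fin M → ℝ) :=
  {w | w ∈ stdSimplex ℝ (Fin M) ∧ ∀ v ∈ stdSimplex ℝ (Fin M), psi C v μ ≤ psi C w μ}

/-! ### The algorithm

`x m i` is the value of the sample number `i` (from `0` on) of arm `m`. For `t ≥ 1`, `A t` is the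
arm sampled at time `t` and `w t` is the plug-in estimate of the optimal proportions at time `t`.
The values `A 0` and `w 0` are not used. -/

/-- `N_m(t)`: the number of times arm `m` is sampled up to time `t`. -/
def pulls (A : ℕ → Fin M) (t : ℕ) (m : Fin M) : ℕ :=
  ((Finset.Icc 1 t).filter fun s => A s = m).card

/-- The empirical mean of each arm at time `t` (`0` for an arm that is not yet sampled). -/
def empMean (x : Fin M → ℕ → EuclideanSpace ℝ (Fin d)) (A : ℕ → Fin M) (t : ℕ) : Means d M :=
  fun m => (pulls A t m : ℝ)⁻¹ • ∑ i ∈ Finset.range (pulls A t m), x m i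

/-- The sum of the plug-in estimates `w_m(s)` over `1 ≤ s ≤ t`. -/
def wSum (w : ℕ → Fin M → ℝ) (t : ℕ) (m : Fin M) : ℝ :=
  ∑ s ∈ Finset.Icc 1 t, w s m

/-- `A` and `w` follow the sampling rule of ATBOC on the sample values `x`, continued for ever.
Ties in the minimizations and the choice among the maximizers are arbitrary, and so is the first
arm. -/
structure IsATBOCRun (C : Means d M → Fin M → Fin K)
    (x : Fin M → ℕ → EuclideanSpace ℝ (Fin d)) (A : ℕ → Fin M) (w : ℕ → Fin M → ℝ) : Prop where
  /-- The plug-in estimate is an optimal proportion vector for the empirical means. -/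
  plugIn : ∀ t : ℕ, 1 ≤ t → w t ∈ optProportions C (empMean x A t)
  /-- Forced exploration: if some arm has fewer than `√(t/M)` samples, sample a rarest arm. -/
  explore : ∀ t : ℕ, 1 ≤ t → (∃ m, (pulls A t m : ℝ) < √((t : ℝ) / M)) →
    ∀ m, pulls A t (A (t + 1)) ≤ pulls A t m
  /-- Average tracking: otherwise sample an arm of the support of `∑_{s ≤ t} w(s)` whose
  proportion of samples lags most behind the average of the plug-in estimates. -/
  track : ∀ t : ℕ, 1 ≤ t → (∀ m, √((t : ℝ) / M) ≤ (pulls A t m : ℝ)) →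
    wSum w t (A (t + 1)) ≠ 0 ∧
    ∀ m, wSum w t m ≠ 0 →
      (pulls A t (A (t + 1)) : ℝ) / t - 1 / t * wSum w t (A (t + 1)) ≤
        (pulls A t m : ℝ) / t - 1 / t * wSum w t m

/-- The statistic `Z(t) = t ψ(N(t)/t, μ̂(t))`. -/
def glrStat (C : Means d M → Fin M → Fin K) (x : Fin M → ℕ → EuclideanSpace ℝ (Fin d))
    (A : ℕ → Fin M) (t : ℕ) : ℝ≥0∞ :=
  t * psi C (fun m => (pulls A t m : ℝ) / t) (empMean x A t)

/-- The threshold `β(δ, t) = 2 log (√(∏_m (N_m(t) + 1)^d) / δ)`, which is positive for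
`0 < δ < 1`. -/
def threshold (d : ℕ) (A : ℕ → Fin M) (δ : ℝ) (t : ℕ) : ℝ :=
  2 * Real.log (√(∏ m, ((pulls A t m : ℝ) + 1) ^ d) / δ)

/-- The stopping time `τ_δ`, the first `t ≥ 1` with `Z(t) ≥ β(δ, t)` (`⊤` if there is none), for
`0 < δ < 1`. -/
def stopTime (C : Means d M → Fin M → Fin K) (x : Fin M → ℕ → EuclideanSpace ℝ (Fin d))
    (A : ℕ → Fin M) (δ : ℝ) : ℕ∞ :=
  ⨅ (t : ℕ) (_ : 1 ≤ t ∧ ENNReal.ofReal (threshold d A δ t) ≤ glrStat C x A t), (t : ℕ∞)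

end BanditClustering

end

/-! The argument is deterministic on each run whose sample means converge; probability enters only
through the strong law of large numbers. Separation is a finite set of strict inequalities, hence
open, and on a separated instance every tie-breaking rule of SLINK gives the same partition. So
`Alt` is constant near `μ` (`eventually_Alt_eq`), and once the empirical means are close, all costs
are infima over one fixed set `S`.

Over this `S`, the value `infCost` is concave and continuous in the weights (`continuousOn_infCost`)
and continuous in the instance uniformly in the weights (`eventually_abs_infCost_sub_le`).
Maximizers need not be unique, so the plug-in weights need not converge, but their values at `μ`
converge to the maximum `1/T*`. By concavity the averaged weights have values with the same limit.
Tracking keeps the sampling proportions within `O(1/√t)` of that average, and uniform continuity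
gives `Z(t)/t → 1/T*`.

The threshold is at most `2 log(1/δ) + O(log t)`. Hence for every `b > 2 T*` the rule has stopped by
time `⌊b log(1/δ)⌋` once `δ` is small. -/

noncomputable section

namespace BanditClustering

variable {d M K : ℕ}

/-! ### Stability of single-linkage clustering -/

/-- Inside each cluster neighbours are closer than `r`, and different clusters are further apart
than `r`. -/
def IsSeparatedAt (x : Means d M) (c : Fin M → Fin K) (r : ℝ) : Prop :=
  (∀ (k : Fin K) (S : Finset (Fin M)), S ⊆ clusterOf c k → S.Nonempty → S ≠ clusterOf c k →
    ∃ i ∈ S, ∃ j ∈ clusterOf c k \ S, armDist x i j < r) ∧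
  ∀ i j, c i ≠ c j → r < armDist x i j

lemma mem_clusterOf {c : Fin M → Fin K} {k : Fin K} {m : Fin M} :
    m ∈ clusterOf c k ↔ c m = k := by
  simp [clusterOf]

lemma setDist_lt_iff {x : Means d M} {S T : Finset (Fin M)} {r : ℝ} :
    setDist x S T < r ↔ ∃ i ∈ S, ∃ j ∈ T, armDist x i j < r := by
  simp [setDist, iInf_lt_iff]

lemma exists_isSeparatedAt {x : Means d M} {c : Fin M → Fin K}
    (h : dIntra x c < dInter x c) : ∃ r, IsSeparatedAt x c r := by
  obtain ⟨r, h₁, h₂⟩ := EReal.lt_iff_exists_real_btwn.1 h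
  refine ⟨r, fun k S hS hne hSk => ?_, fun i j hij => ?_⟩
  · refine setDist_lt_iff.1 (lt_of_le_of_lt ?_ h₁)
    exact le_iSup_of_le k (le_iSup₂_of_le S ⟨hS, hne.ne_empty, hSk⟩ le_rfl)
  · refine EReal.coe_lt_coe_iff.1 (h₂.trans_le ?_)
    exact iInf_le_of_le (c i) (iInf_le_of_le (c j) (iInf_le_of_le hij
      (iInf₂_le_of_le i (mem_clusterOf.2 rfl) (iInf₂_le_of_le j (mem_clusterOf.2 rfl) le_rfl))))

lemma continuous_armDist (i j : Fin M) : Continuous fun x : Means d M => armDist x i j := by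
  unfold armDist; fun_prop

/-- Finitely many splits and pairs are involved, and for each split one crossing pair stays a
witness nearby. -/
lemma IsSeparatedAt.eventually {x : Means d M} {c : Fin M → Fin K} {r : ℝ}
    (h : IsSeparatedAt x c r) : ∀ᶠ y in 𝓝 x, IsSeparatedAt y c r := by
  refine Filter.Eventually.and ?_ ?_
  · refine eventually_all.2 fun k => eventually_all.2 fun S => ?_
    by_cases hS : S ⊆ clusterOf c k ∧ S.Nonempty ∧ S ≠ clusterOf c k
    · obtain ⟨i, hi, j, hj, hij⟩ := h.1 k S hS.1 hS.2.1 hS.2.2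
      filter_upwards [(continuous_armDist i j).continuousAt.eventually_lt continuousAt_const hij]
        with y hy _ _ _
      exact ⟨i, hi, j, hj, hy⟩
    · exact Eventually.of_forall fun y h₁ h₂ h₃ => (hS ⟨h₁, h₂, h₃⟩).elim
  · refine eventually_all.2 fun i => eventually_all.2 fun j => ?_
    by_cases hij : c i = c j
    · exact Eventually.of_forall fun y hc => (hc hij).elim
    · filter_upwards [continuousAt_const.eventually_lt (continuous_armDist i j).continuousAt
        (h.2 i j hij)] with y hy _
      exact hy

lemma SlinkReaches.nonempty {x : Means d M} {Q : Finset (Finset (Fin M))}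
    (h : SlinkReaches x Q) : ∀ S ∈ Q, S.Nonempty := by
  induction h with
  | start => simp
  | merge Q S T hQ hS hT hST hmin ih =>
    intro U hU
    rcases Finset.mem_insert.1 hU with rfl | hU
    · exact (ih S hS).mono Finset.subset_union_left
    · exact ih U (Finset.mem_of_mem_erase (Finset.mem_of_mem_erase hU))

lemma SlinkReaches.exists_mem {x : Means d M} {Q : Finset (Finset (Fin M))}
    (h : SlinkReaches x Q) (m : Fin M) : ∃ S ∈ Q, m ∈ S := by
  induction h with
  | start => exact ⟨{m}, by simp⟩
  | merge Q S T hQ hS hT hST hmin ih =>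
    obtain ⟨U, hU, hm⟩ := ih
    by_cases h : U = S ∨ U = T
    · refine ⟨S ∪ T, Finset.mem_insert_self _ _, ?_⟩
      rcases h with rfl | rfl <;> simp [hm]
    · push Not at h
      exact ⟨U, by simp [h.1, h.2, hU], hm⟩

lemma SlinkReaches.eq_of_mem {x : Means d M} {Q : Finset (Finset (Fin M))}
    (h : SlinkReaches x Q) : ∀ S ∈ Q, ∀ T ∈ Q, ∀ m ∈ S, m ∈ T → S = T := by
  induction h with
  | start =>
    simp only [Finset.mem_image, Finset.mem_univ, true_and, forall_exists_index]
    rintro S i rfl T j rfl m hm hm'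
    rw [Finset.mem_singleton] at hm hm'
    rw [← hm, ← hm']
  | merge Q S T hQ hS hT hST hmin ih =>
    have key : ∀ U ∈ (Q.erase S).erase T, ∀ m ∈ U, m ∉ S ∪ T := by
      intro U hU m hm hm'
      simp only [Finset.mem_erase] at hU
      rcases Finset.mem_union.1 hm' with h' | h'
      · exact hU.2.1 (ih U hU.2.2 S hS m hm h')
      · exact hU.1 (ih U hU.2.2 T hT m hm h')
    intro U hU V hV m hmU hmV
    rcases Finset.mem_insert.1 hU with rfl | hU' <;> rcases Finset.mem_insert.1 hV with rfl | hV'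
    · rfl
    · exact (key V hV' m hmV hmU).elim
    · exact (key U hU' m hmU hmV).elim
    · exact ih U (Finset.mem_of_mem_erase (Finset.mem_of_mem_erase hU')) V
        (Finset.mem_of_mem_erase (Finset.mem_of_mem_erase hV')) m hmU hmV

/-- Representatives of the `K` clusters carry `K` distinct labels, so no label is left over. -/
lemma IsSlinkOutput.surjective {x : Means d M} {c : Fin M → Fin K} (h : IsSlinkOutput x c) :
    Function.Surjective c := by
  obtain ⟨Q, hQ, hcard, hc⟩ := h
  choose f hf using fun S : Q => hQ.nonempty S S.2
  have hinj : Function.Injective fun S : Q => c (f S) := by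
    intro S T hST
    obtain ⟨U, hU, hS, hT⟩ := (hc _ _).1 hST
    exact Subtype.ext ((hQ.eq_of_mem S S.2 U hU _ (hf S) hS).trans
      (hQ.eq_of_mem T T.2 U hU _ (hf T) hT).symm)
  have hbij := (Fintype.bijective_iff_injective_and_card _).2 ⟨hinj, by simp [hcard]⟩
  intro k
  obtain ⟨S, hS⟩ := hbij.2 k
  exact ⟨_, hS⟩

/-- As long as there are at least `K` clusters, single-linkage clustering of a separated instance
stays finer than the separated clustering. -/
lemma SlinkReaches.refines {x : Means d M} {c : Fin M → Fin K} {r : ℝ}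
    (hsep : IsSeparatedAt x c r) {Q : Finset (Finset (Fin M))} (h : SlinkReaches x Q) :
    K ≤ Q.card → ∀ S ∈ Q, ∀ i ∈ S, ∀ j ∈ S, c i = c j := by
  induction h with
  | start =>
    intro _ S hS i hi j hj
    obtain ⟨m, -, rfl⟩ := Finset.mem_image.1 hS
    rw [Finset.mem_singleton.1 hi, Finset.mem_singleton.1 hj]
  | merge Q S T hQ hS hT hST hmin ih =>
    intro hK
    -- A merge removes two clusters and adds at most one, so `Q` has a cluster to spare for the
    -- pigeonhole below.
    have hcard : K < Q.card := by
      have h₁ := Finset.card_insert_le (S ∪ T) ((Q.erase S).erase T)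
      rw [Finset.card_erase_of_mem (by simp [hST.symm, hT]), Finset.card_erase_of_mem hS] at h₁
      have h₂ : 1 < Q.card := Finset.one_lt_card.2 ⟨S, hS, T, hT, hST⟩
      omega
    have hfine := ih hcard.le
    have : Nonempty (Fin M) := ⟨(hQ.nonempty S hS).choose⟩
    choose! f hf using hQ.nonempty
    obtain ⟨U, hU, V, hV, hUV, hfUV⟩ : ∃ U ∈ Q, ∃ V ∈ Q, U ≠ V ∧ c (f U) = c (f V) :=
      Finset.exists_ne_map_eq_of_card_lt_of_maps_to (t := Finset.univ) (by simpa using hcard)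
        (fun _ _ => Finset.mem_univ _)
    -- `U` misses part of its separated cluster, so some arm outside `U` is within `r`. The minimal
    -- merge is then also closer than `r`, too close to join two different separated clusters.
    obtain ⟨i, hi, j, hj, hij⟩ := hsep.1 (c (f U)) U
      (fun m hm => mem_clusterOf.2 (hfine U hU m hm _ (hf U hU))) (hQ.nonempty U hU) (fun h => by
        have : f V ∈ U := h ▸ mem_clusterOf.2 hfUV.symm
        exact hUV (hQ.eq_of_mem U hU V hV _ this (hf V hV)))
    obtain ⟨W, hW, hjW⟩ := hQ.exists_mem j
    have hUW : U ≠ W := by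
      rintro rfl
      exact (Finset.mem_sdiff.1 hj).2 hjW
    obtain ⟨i', hi', j', hj', hij'⟩ := setDist_lt_iff.1
      ((hmin U hU W hW hUW).trans_lt (setDist_lt_iff.2 ⟨i, hi, j, hjW, hij⟩))
    have hc : c i' = c j' := by
      by_contra hne
      exact (hsep.2 i' j' hne).not_gt hij'
    intro Z hZ
    rcases Finset.mem_insert.1 hZ with rfl | hZ
    · have key : ∀ m ∈ S ∪ T, c m = c i' := by
        intro m hm
        rcases Finset.mem_union.1 hm with hm | hm
        · exact hfine S hS m hm i' hi'
        · exact (hfine T hT m hm j' hj').trans hc.symm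
      intro a ha b hb
      rw [key a ha, key b hb]
    · exact hfine Z (Finset.mem_of_mem_erase (Finset.mem_of_mem_erase hZ))

/-- Since `c'` refines `c`, there is an induced map of labels `Fin K → Fin K`. It is onto because
`c` uses all labels, hence it is a permutation. -/
lemma IsSeparatedAt.clusterEquiv {x : Means d M} {c c' : Fin M → Fin K} {r : ℝ}
    (hsep : IsSeparatedAt x c r) (hc : Function.Surjective c) (hc' : IsSlinkOutput x c') :
    ClusterEquiv c' c := by
  have hsurj := hc'.surjective
  obtain ⟨Q, hQ, hcard, hlevel⟩ := hc'
  have href : ∀ i j, c' i = c' j → c i = c j := by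
    intro i j hij
    obtain ⟨S, hS, hi, hj⟩ := (hlevel i j).1 hij
    exact hQ.refines hsep hcard.ge S hS i hi j hj
  choose g hg using hsurj
  have hfac : ∀ m, c (g (c' m)) = c m := fun m => href _ _ (hg _)
  have hbij : Function.Bijective fun k => c (g k) := by
    refine Finite.surjective_iff_bijective.1 fun k => ?_
    obtain ⟨m, rfl⟩ := hc k
    exact ⟨c' m, hfac m⟩
  refine ⟨(Equiv.ofBijective _ hbij).symm, fun m => ?_⟩
  rw [Equiv.eq_symm_apply]
  exact hfac m

lemma ClusterEquiv.symm {c₁ c₂ : Fin M → Fin K} (h : ClusterEquiv c₁ c₂) : ClusterEquiv c₂ c₁ := by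
  obtain ⟨σ, hσ⟩ := h
  exact ⟨σ.symm, fun m => by simp [hσ]⟩

lemma ClusterEquiv.trans {c₁ c₂ c₃ : Fin M → Fin K} (h : ClusterEquiv c₁ c₂)
    (h' : ClusterEquiv c₂ c₃) : ClusterEquiv c₁ c₃ := by
  obtain ⟨σ, hσ⟩ := h
  obtain ⟨σ', hσ'⟩ := h'
  exact ⟨σ'.trans σ, fun m => by simp [hσ, hσ']⟩

lemma Alt_eq_of_clusterEquiv {C : Means d M → Fin M → Fin K} {μ ν : Means d M}
    (h : ClusterEquiv (C ν) (C μ)) : Alt C ν = Alt C μ := by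
  ext l
  exact not_congr ⟨fun h' => h'.trans h, fun h' => h'.trans h.symm⟩

lemma eventually_Alt_eq {C : Means d M → Fin M → Fin K} (hC : IsSlinkMap C) {μ : Means d M}
    (hμ : dIntra μ (C μ) < dInter μ (C μ)) : ∀ᶠ ν in 𝓝 μ, Alt C ν = Alt C μ := by
  obtain ⟨r, hr⟩ := exists_isSeparatedAt hμ
  filter_upwards [hr.eventually] with ν hν
  exact Alt_eq_of_clusterEquiv (hν.clusterEquiv (hC μ).surjective (hC ν))

/-! ### The transportation cost -/

/-- The weighted squared distance between two instances. -/
def weightedCost (w : Fin M → ℝ) (l μ : Means d M) : ℝ :=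
  (1 / 2) * ∑ m, w m * ‖l m - μ m‖ ^ 2

/-- The smallest weighted squared distance of `μ` to a set of instances. -/
def infCost (S : Set (Means d M)) (w : Fin M → ℝ) (μ : Means d M) : ℝ :=
  ⨅ l : S, weightedCost w l μ

lemma weightedCost_nonneg {w : Fin M → ℝ} (hw : 0 ≤ w) (l μ : Means d M) :
    0 ≤ weightedCost w l μ :=
  mul_nonneg (by norm_num) (Finset.sum_nonneg fun m _ => mul_nonneg (hw m) (by positivity))

lemma weightedCost_mono {w w' : Fin M → ℝ} (h : w ≤ w') (l μ : Means d M) :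
    weightedCost w l μ ≤ weightedCost w' l μ := by
  unfold weightedCost
  gcongr with m
  exact h m

lemma weightedCost_smul (a : ℝ) (w : Fin M → ℝ) (l μ : Means d M) :
    weightedCost (a • w) l μ = a * weightedCost w l μ := by
  simp only [weightedCost, Pi.smul_apply, smul_eq_mul, Finset.mul_sum]
  exact Finset.sum_congr rfl fun _ _ => by ring

lemma weightedCost_sum {ι : Type*} (s : Finset ι) (w : ι → Fin M → ℝ) (l μ : Means d M) :
    weightedCost (∑ i ∈ s, w i) l μ = ∑ i ∈ s, weightedCost (w i) l μ := by
  simp only [weightedCost, Finset.sum_apply, Finset.sum_mul, Finset.mul_sum]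
  exact Finset.sum_comm

lemma continuous_weightedCost_left (l μ : Means d M) :
    Continuous fun w : Fin M → ℝ => weightedCost w l μ := by
  unfold weightedCost; fun_prop

lemma continuous_weightedCost_right (w : Fin M → ℝ) (l : Means d M) :
    Continuous fun μ : Means d M => weightedCost w l μ := by
  unfold weightedCost; fun_prop

lemma infCost_le {S : Set (Means d M)} {w : Fin M → ℝ} (hw : 0 ≤ w) {l : Means d M} (hl : l ∈ S)
    (μ : Means d M) : infCost S w μ ≤ weightedCost w l μ :=
  ciInf_le ⟨0, by rintro _ ⟨l, rfl⟩; exact weightedCost_nonneg hw _ _⟩ (⟨l, hl⟩ : S)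

lemma le_infCost {S : Set (Means d M)} (hS : S.Nonempty) {w : Fin M → ℝ} {μ : Means d M} {a : ℝ}
    (h : ∀ l ∈ S, a ≤ weightedCost w l μ) : a ≤ infCost S w μ :=
  have := hS.to_subtype
  le_ciInf fun l => h l l.2

lemma infCost_nonneg {S : Set (Means d M)} {w : Fin M → ℝ} (hw : 0 ≤ w) (μ : Means d M) :
    0 ≤ infCost S w μ :=
  Real.iInf_nonneg fun _ => weightedCost_nonneg hw _ _

/-- Nonemptiness matters: over the empty set the real infimum is `0`, whereas `psi` is `⊤`. -/
lemma psi_eq_ofReal_infCost (C : Means d M → Fin M → Fin K) {w : Fin M → ℝ} {μ : Means d M}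
    (hS : (Alt C μ).Nonempty) : psi C w μ = ENNReal.ofReal (infCost (Alt C μ) w μ) := by
  have := hS.to_subtype
  rw [infCost, ENNReal.ofReal_iInf, psi, iInf_subtype']
  rfl

lemma nonneg_of_mem_stdSimplex {w : Fin M → ℝ} (hw : w ∈ stdSimplex ℝ (Fin M)) : 0 ≤ w := hw.1

lemma le_one_of_mem_stdSimplex {w : Fin M → ℝ} (hw : w ∈ stdSimplex ℝ (Fin M)) (m : Fin M) :
    w m ≤ 1 :=
  hw.2 ▸ Finset.single_le_sum (fun i _ => hw.1 i) (Finset.mem_univ m)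

/-- Vanishing coordinates of `w` are harmless because weights in the simplex are nonnegative. -/
lemma eventually_smul_le {θ : ℝ} (hθ₀ : 0 ≤ θ) (hθ : θ < 1) (w : Fin M → ℝ) :
    ∀ᶠ w' in 𝓝[stdSimplex ℝ (Fin M)] w, θ • w ≤ w' := by
  refine eventually_all.2 fun m => ?_
  rcases le_or_gt (w m) 0 with h | h
  · filter_upwards [self_mem_nhdsWithin] with w' hw'
    exact (mul_nonpos_of_nonneg_of_nonpos hθ₀ h).trans (hw'.1 m)
  · have : Tendsto (fun w' : Fin M → ℝ => w' m) (𝓝[stdSimplex ℝ (Fin M)] w) (𝓝 (w m)) :=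
      ((continuous_apply m).tendsto w).mono_left nhdsWithin_le_nhds
    filter_upwards [this.eventually (lt_mem_nhds (show θ * w m < w m by nlinarith))] with w' hw'
    exact hw'.le

/-- Upper semicontinuity is automatic for an infimum of continuous functions. For the lower half `S`
may be unbounded, so compactness is replaced by monotonicity and homogeneity: nearby weights
dominate `θ • w` with `θ` close to `1`. -/
lemma continuousOn_infCost {S : Set (Means d M)} (hS : S.Nonempty) (μ : Means d M) :
    ContinuousOn (fun w => infCost S w μ) (stdSimplex ℝ (Fin M)) := by
  intro w hw
  have hw0 := nonneg_of_mem_stdSimplex hw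
  refine tendsto_order.2 ⟨fun a ha => ?_, fun b hb => ?_⟩
  · rcases lt_or_ge a 0 with ha0 | ha0
    · filter_upwards [self_mem_nhdsWithin] with w' hw'
      exact ha0.trans_le (infCost_nonneg (nonneg_of_mem_stdSimplex hw') μ)
    · have hpos := ha0.trans_lt ha
      obtain ⟨θ, hθ, hθ1⟩ := exists_between ((div_lt_one hpos).2 ha)
      have hθ0 : 0 ≤ θ := (div_nonneg ha0 hpos.le).trans hθ.le
      filter_upwards [eventually_smul_le hθ0 hθ1 w] with w' hw'
      refine ((div_lt_iff₀ hpos).1 hθ).trans_le (le_infCost hS fun l hl => ?_)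
      calc θ * infCost S w μ ≤ θ * weightedCost w l μ := by
            gcongr; exact infCost_le hw0 hl μ
        _ = weightedCost (θ • w) l μ := (weightedCost_smul _ _ _ _).symm
        _ ≤ weightedCost w' l μ := weightedCost_mono hw' l μ
  · have := hS.to_subtype
    obtain ⟨l, hl⟩ := exists_lt_of_ciInf_lt hb
    filter_upwards [self_mem_nhdsWithin, nhdsWithin_le_nhds
      ((continuous_weightedCost_left (l : Means d M) μ).continuousAt.eventually_lt
        continuousAt_const hl)] with w' hw' hlt
    exact (infCost_le (nonneg_of_mem_stdSimplex hw') l.2 μ).trans_lt hlt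

/-- Concavity of `infCost` in the weights, for an average. -/
lemma average_infCost_le {S : Set (Means d M)} (hS : S.Nonempty) (μ : Means d M) {ι : Type*}
    (s : Finset ι) {w : ι → Fin M → ℝ} (hw : ∀ i ∈ s, 0 ≤ w i) {a : ℝ} (ha : 0 ≤ a) :
    a * ∑ i ∈ s, infCost S (w i) μ ≤ infCost S (a • ∑ i ∈ s, w i) μ := by
  refine le_infCost hS fun l hl => ?_
  rw [weightedCost_smul, weightedCost_sum]
  gcongr with i hi
  exact infCost_le (hw i hi) hl μ

/-- Young's inequality with parameter `η`: the main term keeps a factor close to `1`, and the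
distance between the instances absorbs the large constant. -/
lemma weightedCost_triangle {w : Fin M → ℝ} (hw : 0 ≤ w) {η : ℝ} (hη : 0 < η)
    (l μ ν : Means d M) :
    weightedCost w l μ ≤ (1 + η) * weightedCost w l ν + (1 + η⁻¹) * weightedCost w ν μ := by
  simp only [weightedCost, Finset.mul_sum]
  rw [← Finset.sum_add_distrib]
  refine Finset.sum_le_sum fun m _ => ?_
  have h₁ : ‖l m - μ m‖ ^ 2 ≤ (‖l m - ν m‖ + ‖ν m - μ m‖) ^ 2 := by
    gcongr
    exact norm_sub_le_norm_sub_add_norm_sub _ _ _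
  have h₂ : (‖l m - ν m‖ + ‖ν m - μ m‖) ^ 2
      ≤ (1 + η) * ‖l m - ν m‖ ^ 2 + (1 + η⁻¹) * ‖ν m - μ m‖ ^ 2 := by
    set a := ‖l m - ν m‖
    set b := ‖ν m - μ m‖
    have : 0 ≤ η⁻¹ * (η * a - b) ^ 2 := by positivity
    have e : η⁻¹ * (η * a - b) ^ 2 = η * a ^ 2 - 2 * a * b + η⁻¹ * b ^ 2 := by
      field_simp; ring
    nlinarith
  have := mul_le_mul_of_nonneg_left (h₁.trans h₂) (hw m)
  linarith

/-- `infCost` is continuous in the instance, uniformly in the weights. -/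
lemma eventually_abs_infCost_sub_le {S : Set (Means d M)} (hS : S.Nonempty) (μ : Means d M) {ε : ℝ}
    (hε : 0 < ε) : ∀ᶠ ν in 𝓝 μ, ∀ w ∈ stdSimplex ℝ (Fin M),
      |infCost S w ν - infCost S w μ| ≤ ε := by
  obtain ⟨l₀, hl₀⟩ := hS
  have hone : ∀ w ∈ stdSimplex ℝ (Fin M), w ≤ 1 := fun w hw m => le_one_of_mem_stdSimplex hw m
  -- The single alternative `l₀` bounds the value by `B` for all weights and all nearby instances;
  -- `η` is chosen so that `η * B = ε / 2`.
  set B := weightedCost 1 l₀ μ + 1 with hB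
  have hB0 : 0 < B := by
    have := weightedCost_nonneg (zero_le_one' (Fin M → ℝ)) l₀ μ
    linarith
  set η := ε / (2 * B) with hη
  have hη0 : 0 < η := by positivity
  have hsmall : ∀ᶠ ν in 𝓝 μ, (1 + η⁻¹) * weightedCost 1 ν μ < ε / 2 := by
    have hc : Continuous fun ν : Means d M => (1 + η⁻¹) * weightedCost 1 ν μ := by
      unfold weightedCost; fun_prop
    refine hc.continuousAt.eventually_lt continuousAt_const ?_
    simpa [weightedCost] using hε
  have hbdd : ∀ᶠ ν in 𝓝 μ, weightedCost 1 l₀ ν < B :=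
    (continuous_weightedCost_right 1 l₀).continuousAt.eventually_lt continuousAt_const
      (by linarith)
  have key : ∀ ν ν' : Means d M, weightedCost 1 l₀ ν ≤ B → (1 + η⁻¹) * weightedCost 1 ν ν' < ε / 2 →
      ∀ w ∈ stdSimplex ℝ (Fin M), infCost S w ν' ≤ infCost S w ν + ε := by
    intro ν ν' hν hνν' w hw
    have hw0 := nonneg_of_mem_stdSimplex hw
    have h₁ : infCost S w ν ≤ B :=
      (infCost_le hw0 hl₀ ν).trans ((weightedCost_mono (hone w hw) _ _).trans hν)
    have h₂ : infCost S w ν' - ε / 2 ≤ (1 + η) * infCost S w ν := by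
      rw [← div_le_iff₀' (by positivity)]
      refine le_infCost ⟨l₀, hl₀⟩ fun l hl => ?_
      rw [div_le_iff₀' (by positivity)]
      have h₃ := infCost_le hw0 hl ν'
      have h₄ := weightedCost_triangle hw0 hη0 l ν' ν
      have h₅ : (1 + η⁻¹) * weightedCost w ν ν' ≤ (1 + η⁻¹) * weightedCost 1 ν ν' :=
        mul_le_mul_of_nonneg_left (weightedCost_mono (hone w hw) _ _) (by positivity)
      linarith
    have h₆ : η * infCost S w ν ≤ ε / 2 := by
      calc η * infCost S w ν ≤ η * B := by gcongr
        _ = ε / 2 := by rw [hη]; field_simp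
    linarith
  filter_upwards [hsmall, hbdd] with ν h₁ h₂ w hw
  have hsymm : weightedCost 1 μ ν = weightedCost 1 ν μ := by
    simp only [weightedCost, norm_sub_rev]
  rw [abs_sub_le_iff]
  constructor
  · linarith [key μ ν (by linarith) (hsymm ▸ h₁) w hw]
  · linarith [key ν μ h₂.le h₁ w hw]

/-! ### The sampling rule -/

lemma pulls_zero (A : ℕ → Fin M) (m : Fin M) : pulls A 0 m = 0 := by simp [pulls]

lemma pulls_succ (A : ℕ → Fin M) (t : ℕ) (m : Fin M) :
    pulls A (t + 1) m = pulls A t m + if A (t + 1) = m then 1 else 0 := by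
  unfold pulls
  rw [← Finset.insert_Icc_right_eq_Icc_add_one (by omega), Finset.filter_insert]
  split_ifs with h
  · rw [Finset.card_insert_of_notMem (by simp)]
  · rfl

lemma sum_pulls (A : ℕ → Fin M) (t : ℕ) : ∑ m, pulls A t m = t := by
  induction t with
  | zero => simp [pulls_zero]
  | succ t ih => simp [pulls_succ, Finset.sum_add_distrib, ih]

lemma pulls_le (A : ℕ → Fin M) (t : ℕ) (m : Fin M) : pulls A t m ≤ t :=
  (Finset.single_le_sum (f := pulls A t) (fun _ _ => Nat.zero_le _) (Finset.mem_univ m)).trans_eq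
    (sum_pulls A t)

lemma monotone_pulls (A : ℕ → Fin M) (m : Fin M) : Monotone fun t => pulls A t m :=
  monotone_nat_of_le_succ fun t => by simp [pulls_succ]

lemma pulls_div_mem_stdSimplex (A : ℕ → Fin M) {t : ℕ} (ht : 1 ≤ t) :
    (fun m => (pulls A t m : ℝ) / t) ∈ stdSimplex ℝ (Fin M) := by
  refine ⟨fun m => by positivity, ?_⟩
  rw [← Finset.sum_div, ← Nat.cast_sum, sum_pulls, div_self (by positivity)]

lemma wSum_eq_sum (w : ℕ → Fin M → ℝ) (t : ℕ) : wSum w t = ∑ s ∈ Finset.Icc 1 t, w s := by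
  ext m; simp [wSum]

lemma wSum_succ (w : ℕ → Fin M → ℝ) (t : ℕ) (m : Fin M) :
    wSum w (t + 1) m = wSum w t m + w (t + 1) m := by
  rw [wSum, Finset.sum_Icc_succ_top (by omega)]; rfl

section Run

variable {C : Means d M → Fin M → Fin K} {x : Fin M → ℕ → EuclideanSpace ℝ (Fin d)}
  {A : ℕ → Fin M} {w : ℕ → Fin M → ℝ}

lemma IsATBOCRun.mem_stdSimplex (h : IsATBOCRun C x A w) {t : ℕ} (ht : 1 ≤ t) :
    w t ∈ stdSimplex ℝ (Fin M) :=
  (h.plugIn t ht).1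

lemma IsATBOCRun.wSum_nonneg (h : IsATBOCRun C x A w) (t : ℕ) (m : Fin M) : 0 ≤ wSum w t m :=
  Finset.sum_nonneg fun _ hs => (h.mem_stdSimplex (Finset.mem_Icc.1 hs).1).1 m

lemma IsATBOCRun.sum_wSum (h : IsATBOCRun C x A w) (t : ℕ) : ∑ m, wSum w t m = t := by
  unfold wSum
  rw [Finset.sum_comm, Finset.sum_congr rfl fun s hs =>
    (h.mem_stdSimplex (Finset.mem_Icc.1 hs).1).2]
  simp

lemma IsATBOCRun.wSum_div_mem_stdSimplex (h : IsATBOCRun C x A w) {t : ℕ} (ht : 1 ≤ t) :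
    (fun m => wSum w t m / t) ∈ stdSimplex ℝ (Fin M) := by
  refine ⟨fun m => div_nonneg (h.wSum_nonneg t m) (by positivity), ?_⟩
  rw [← Finset.sum_div, h.sum_wSum, div_self (by positivity)]

/-- Forced exploration samples every arm infinitely often. -/
lemma IsATBOCRun.tendsto_pulls (h : IsATBOCRun C x A w) (m : Fin M) :
    Tendsto (fun t => pulls A t m) atTop atTop := by
  refine tendsto_atTop_atTop_of_monotone (monotone_pulls A m) fun B => ?_
  by_contra! hB
  have hM : (0 : ℝ) < M := by exact_mod_cast m.pos
  -- Beyond `M * B ^ 2`, an arm with fewer than `B` samples triggers exploration at every step. Only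
  -- arms with at most `B` samples are then drawn, so all counts stay bounded, although they sum to
  -- `t`.
  obtain ⟨t₀, ht₀⟩ := exists_nat_gt ((M : ℝ) * B ^ 2)
  have hstep : ∀ t ≥ t₀ + 1, pulls A t (A (t + 1)) ≤ B := by
    intro t ht
    refine (h.explore t (by omega) ⟨m, ?_⟩ m).trans (hB t).le
    refine Real.lt_sqrt_of_sq_lt ((lt_div_iff₀' hM).2 ?_)
    have h₁ : (pulls A t m : ℝ) ≤ B := by exact_mod_cast (hB t).le
    have h₂ : (t₀ : ℝ) ≤ t := by exact_mod_cast (by omega : t₀ ≤ t)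
    calc (M : ℝ) * (pulls A t m : ℝ) ^ 2 ≤ M * (B : ℝ) ^ 2 := by gcongr
      _ < (t : ℝ) := by linarith
  have hbound : ∀ t ≥ t₀ + 1, ∀ i, pulls A t i ≤ max (t₀ + 1) (B + 1) := by
    intro t ht
    induction t, ht using Nat.le_induction with
    | base => exact fun i => (pulls_le A _ i).trans (le_max_left _ _)
    | succ t ht ih =>
      intro i
      rw [pulls_succ]
      split_ifs with hi
      · exact (Nat.add_le_add_right (hi ▸ hstep t ht) 1).trans (le_max_right _ _)
      · exact ih i
  set b := max (t₀ + 1) (B + 1)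
  have hsum := sum_pulls A (t₀ + 1 + M * b)
  have hle : ∑ i, pulls A (t₀ + 1 + M * b) i ≤ M * b := by
    refine (Finset.sum_le_sum fun i _ => hbound _ (by omega) i).trans_eq ?_
    simp
  omega

/-- The excess of an arm grows only when the arm is drawn, and then by at most one. Before such a
draw it is below `√t` under exploration and at most `0` under tracking. -/
lemma IsATBOCRun.pulls_sub_wSum_le (h : IsATBOCRun C x A w) {t : ℕ} (ht : 1 ≤ t) (m : Fin M) :
    (pulls A t m : ℝ) - wSum w t m ≤ √t + 1 := by
  have hM : (1 : ℝ) ≤ M := by exact_mod_cast m.pos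
  induction t, ht using Nat.le_induction generalizing m with
  | base =>
    have h₁ : (pulls A 1 m : ℝ) ≤ 1 := by exact_mod_cast pulls_le A 1 m
    linarith [h.wSum_nonneg 1 m, Real.sqrt_nonneg ((1 : ℕ) : ℝ)]
  | succ t ht ih =>
    have hmono : √(t : ℝ) ≤ √((t : ℝ) + 1) := Real.sqrt_le_sqrt (by linarith)
    have hw := (h.mem_stdSimplex (t := t + 1) (by omega)).1 m
    rw [pulls_succ, wSum_succ]
    by_cases hA : A (t + 1) = m
    · rw [if_pos hA]
      push_cast
      by_cases hex : ∃ i, (pulls A t i : ℝ) < √((t : ℝ) / M)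
      · obtain ⟨i, hi⟩ := hex
        have h₁ : (pulls A t m : ℝ) ≤ pulls A t i := by
          exact_mod_cast hA ▸ h.explore t ht ⟨i, hi⟩ i
        have h₂ : √((t : ℝ) / M) ≤ √t := Real.sqrt_le_sqrt (div_le_self (by positivity) hM)
        linarith [h.wSum_nonneg t m]
      · push Not at hex
        have htr := (h.track t ht hex).2
        rw [hA] at htr
        have hle : (pulls A t m : ℝ) - wSum w t m ≤ 0 := by
          by_contra! hpos
          -- Excesses sum to zero, so the least one cannot be positive; arms outside the support
          -- have nonnegative excess and cannot spoil this.
          have hall : ∀ i, wSum w t i ≤ pulls A t i := by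
            intro i
            by_cases hi : wSum w t i = 0
            · rw [hi]; positivity
            · have := htr i hi
              have ht' : (0 : ℝ) < t := by exact_mod_cast ht
              rw [one_div_mul_eq_div, one_div_mul_eq_div, ← sub_div, ← sub_div,
                div_le_div_iff_of_pos_right ht'] at this
              linarith
          have : ∑ i, wSum w t i < ∑ i, (pulls A t i : ℝ) :=
            Finset.sum_lt_sum (fun i _ => hall i) ⟨m, Finset.mem_univ m, by linarith⟩
          rw [h.sum_wSum, ← Nat.cast_sum, sum_pulls] at this
          exact this.false
        linarith [Real.sqrt_nonneg ((t : ℝ) + 1)]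
    · rw [if_neg hA]
      push_cast
      linarith [ih m]

/-- The lower bound comes from the upper one: excesses sum to zero, so one arm's deficit is balanced
by the excesses of the others. -/
lemma IsATBOCRun.abs_pulls_sub_wSum_le (h : IsATBOCRun C x A w) {t : ℕ} (ht : 1 ≤ t) (m : Fin M) :
    |(pulls A t m : ℝ) - wSum w t m| ≤ M * (√t + 1) := by
  have hM : (1 : ℝ) ≤ M := by exact_mod_cast m.pos
  have hs : 0 ≤ √(t : ℝ) := Real.sqrt_nonneg _
  refine abs_le.2 ⟨?_, (h.pulls_sub_wSum_le ht m).trans (by nlinarith)⟩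
  have hsum : ∑ i, ((pulls A t i : ℝ) - wSum w t i) = 0 := by
    rw [Finset.sum_sub_distrib, h.sum_wSum, ← Nat.cast_sum, sum_pulls, sub_self]
  have h₁ : ∑ i, (√t + 1 - ((pulls A t i : ℝ) - wSum w t i)) = M * (√t + 1) := by
    rw [Finset.sum_sub_distrib, hsum]; simp [mul_add]
  have h₂ := Finset.single_le_sum (f := fun i => √t + 1 - ((pulls A t i : ℝ) - wSum w t i))
    (fun i _ => sub_nonneg.2 (h.pulls_sub_wSum_le ht i)) (Finset.mem_univ m)
  simp only [h₁] at h₂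
  linarith

/-- The proportions of samples track the average of the plug-in estimates. -/
lemma IsATBOCRun.tendsto_pulls_sub_wSum (h : IsATBOCRun C x A w) :
    Tendsto (fun t : ℕ => (fun m => (pulls A t m : ℝ) / t) - fun m => wSum w t m / t)
      atTop (𝓝 0) := by
  refine tendsto_pi_nhds.2 fun m => ?_
  have hlim : Tendsto (fun t : ℕ => M * ((√(t : ℝ))⁻¹ + (t : ℝ)⁻¹)) atTop (𝓝 0) := by
    have h₁ : Tendsto (fun t : ℕ => (√(t : ℝ))⁻¹) atTop (𝓝 0) :=
      tendsto_inv_atTop_zero.comp (Real.tendsto_sqrt_atTop.comp tendsto_natCast_atTop_atTop)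
    simpa using (h₁.add tendsto_inv_atTop_nhds_zero_nat).const_mul (M : ℝ)
  refine squeeze_zero_norm' ?_ hlim
  filter_upwards [eventually_ge_atTop 1] with t ht
  have ht' : (0 : ℝ) < t := by exact_mod_cast ht
  rw [Pi.sub_apply, ← sub_div, norm_div, Real.norm_eq_abs, Real.norm_of_nonneg ht'.le,
    div_le_iff₀ ht']
  refine (h.abs_pulls_sub_wSum_le ht m).trans_eq ?_
  have hs : (√(t : ℝ))⁻¹ * t = √t := by
    rw [inv_mul_eq_div, Real.div_sqrt]
  rw [mul_assoc, add_mul, hs, inv_mul_cancel₀ ht'.ne']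

lemma IsATBOCRun.tendsto_empMean (h : IsATBOCRun C x A w) {μ : Means d M}
    (hx : ∀ m, Tendsto (fun n : ℕ => (n : ℝ)⁻¹ • ∑ i ∈ Finset.range n, x m i) atTop (𝓝 (μ m))) :
    Tendsto (empMean x A) atTop (𝓝 μ) :=
  tendsto_pi_nhds.2 fun m => (hx m).comp (h.tendsto_pulls m)

end Run

/-! ### The stopping time -/

lemma stopTime_le {C : Means d M → Fin M → Fin K} {x : Fin M → ℕ → EuclideanSpace ℝ (Fin d)}
    {A : ℕ → Fin M} {δ : ℝ} {t : ℕ} (ht : 1 ≤ t)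
    (h : ENNReal.ofReal (threshold d A δ t) ≤ glrStat C x A t) : stopTime C x A δ ≤ t :=
  iInf₂_le t ⟨ht, h⟩

lemma threshold_le (A : ℕ → Fin M) {δ : ℝ} (hδ : 0 < δ) (t : ℕ) :
    threshold d A δ t ≤ 2 * Real.log (1 / δ) + M * d * Real.log (t + 1) := by
  have hpos : ∀ m, (0 : ℝ) < ((pulls A t m : ℝ) + 1) ^ d := fun m => by positivity
  have hprod : 0 < ∏ m, ((pulls A t m : ℝ) + 1) ^ d := Finset.prod_pos fun m _ => hpos m
  have hlog : Real.log (∏ m, ((pulls A t m : ℝ) + 1) ^ d) ≤ M * d * Real.log (t + 1) := by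
    rw [Real.log_prod fun m _ => (hpos m).ne']
    calc ∑ m, Real.log (((pulls A t m : ℝ) + 1) ^ d)
        ≤ ∑ _m : Fin M, d * Real.log (t + 1) := by
          refine Finset.sum_le_sum fun m _ => ?_
          rw [Real.log_pow]
          gcongr
          exact pulls_le A t m
      _ = M * d * Real.log (t + 1) := by simp [mul_assoc]
  rw [threshold, Real.log_div (Real.sqrt_pos.2 hprod).ne' hδ.ne', Real.log_sqrt hprod.le,
    one_div, Real.log_inv]
  linarith

lemma tendsto_log_one_div : Tendsto (fun δ : ℝ => Real.log (1 / δ)) (𝓝[>] 0) atTop := by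
  simp only [one_div]
  exact Real.tendsto_log_atTop.comp tendsto_inv_nhdsGT_zero

lemma tendsto_log_add_one_div (c : ℝ) :
    Tendsto (fun t : ℕ => c * Real.log ((t : ℝ) + 1) / t) atTop (𝓝 0) := by
  have h₁ : Tendsto (fun t : ℕ => Real.log ((t : ℝ) + 1) / ((t : ℝ) + 1)) atTop (𝓝 0) := by
    have := (Real.isLittleO_log_id_atTop.tendsto_div_nhds_zero).comp
      (tendsto_atTop_add_const_right atTop (1 : ℝ) tendsto_natCast_atTop_atTop)
    simpa [Function.comp_def] using this
  have h₂ : Tendsto (fun t : ℕ => 1 + (t : ℝ)⁻¹) atTop (𝓝 1) := by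
    simpa using tendsto_inv_atTop_nhds_zero_nat.const_add (1 : ℝ)
  have h₃ := (h₁.mul h₂).const_mul c
  rw [zero_mul, mul_zero] at h₃
  refine h₃.congr' ?_
  filter_upwards [eventually_ge_atTop 1] with t ht
  have : (0 : ℝ) < t := by exact_mod_cast ht
  field_simp

/-! ### Convergence of `Z(t) / t` and the asymptotic stopping bound -/

section Run

variable {C : Means d M → Fin M → Fin K} {x : Fin M → ℕ → EuclideanSpace ℝ (Fin d)}
  {A : ℕ → Fin M} {w : ℕ → Fin M → ℝ} {μ : Means d M}

/-- The plug-in estimates are asymptotically optimal for the true instance. -/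
lemma IsATBOCRun.tendsto_infCost_plugIn (h : IsATBOCRun C x A w) (hS : (Alt C μ).Nonempty)
    (hAlt : ∀ᶠ t in atTop, Alt C (empMean x A t) = Alt C μ)
    (hmean : Tendsto (empMean x A) atTop (𝓝 μ)) {u : Fin M → ℝ} (hu : u ∈ stdSimplex ℝ (Fin M))
    (hmax : ∀ v ∈ stdSimplex ℝ (Fin M), infCost (Alt C μ) v μ ≤ infCost (Alt C μ) u μ) :
    Tendsto (fun t => infCost (Alt C μ) (w t) μ) atTop (𝓝 (infCost (Alt C μ) u μ)) := by
  refine Metric.tendsto_atTop'.2 fun ε hε => ?_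
  have hev : ∀ᶠ t in atTop, dist (infCost (Alt C μ) (w t) μ) (infCost (Alt C μ) u μ) < ε := by
    filter_upwards [hAlt, hmean.eventually (eventually_abs_infCost_sub_le hS μ
      (show 0 < ε / 3 by positivity)), eventually_ge_atTop 1] with t h₁ h₂ ht
    -- `w t` beats `u` at the empirical means; moving both values to `μ` costs `ε / 3` each.
    have hw := h.mem_stdSimplex ht
    have hopt := (h.plugIn t ht).2 u hu
    rw [psi_eq_ofReal_infCost C (h₁ ▸ hS), psi_eq_ofReal_infCost C (h₁ ▸ hS), h₁,
      ENNReal.ofReal_le_ofReal_iff (infCost_nonneg (nonneg_of_mem_stdSimplex hw) _)] at hopt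
    have h₃ := abs_le.1 (h₂ _ hw)
    have h₄ := abs_le.1 (h₂ u hu)
    have h₅ := hmax _ hw
    rw [Real.dist_eq, abs_lt]
    constructor <;> linarith
  obtain ⟨N, hN⟩ := eventually_atTop.1 hev
  exact ⟨N, fun n hn => hN n hn.le⟩

/-- Concavity bounds the value of the average below by the Cesàro mean of the values, and maximality
of `v` bounds it above. -/
lemma IsATBOCRun.tendsto_infCost_wSum (h : IsATBOCRun C x A w) (hS : (Alt C μ).Nonempty)
    {v : ℝ} (hmax : ∀ u ∈ stdSimplex ℝ (Fin M), infCost (Alt C μ) u μ ≤ v)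
    (hw : Tendsto (fun t => infCost (Alt C μ) (w t) μ) atTop (𝓝 v)) :
    Tendsto (fun t : ℕ => infCost (Alt C μ) (fun m => wSum w t m / t) μ) atTop (𝓝 v) := by
  -- The shift drops the unused `w 0`.
  have hces := ((tendsto_add_atTop_iff_nat 1).2 hw).cesaro
  refine tendsto_of_tendsto_of_tendsto_of_le_of_le' hces tendsto_const_nhds ?_ ?_
  · filter_upwards with t
    have hsum : ∀ f : ℕ → ℝ, ∑ i ∈ Finset.range t, f (i + 1) = ∑ s ∈ Finset.Icc 1 t, f s := by
      intro f
      rw [Finset.range_eq_Ico, Finset.sum_Ico_add']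
      rfl
    have heq : (fun m => wSum w t m / t) = (t : ℝ)⁻¹ • ∑ s ∈ Finset.Icc 1 t, w s := by
      rw [← wSum_eq_sum]
      ext m
      simp [div_eq_inv_mul]
    rw [heq, hsum fun s => infCost (Alt C μ) (w s) μ]
    exact average_infCost_le hS μ _ (fun s hs => nonneg_of_mem_stdSimplex
      (h.mem_stdSimplex (Finset.mem_Icc.1 hs).1)) (by positivity)
  · filter_upwards [eventually_ge_atTop 1] with t ht
    exact hmax _ (h.wSum_div_mem_stdSimplex ht)

/-- Two replacements: the averaged weights by the sampling proportions, by uniform continuity on the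
compact simplex, and `μ` by the empirical means, uniformly in the weights. -/
lemma IsATBOCRun.tendsto_infCost_pulls (h : IsATBOCRun C x A w) (hS : (Alt C μ).Nonempty) {v : ℝ}
    (hmean : Tendsto (empMean x A) atTop (𝓝 μ))
    (hw : Tendsto (fun t : ℕ => infCost (Alt C μ) (fun m => wSum w t m / t) μ) atTop (𝓝 v)) :
    Tendsto (fun t : ℕ => infCost (Alt C μ) (fun m => (pulls A t m : ℝ) / t) (empMean x A t))
      atTop (𝓝 v) := by
  have huc := (isCompact_stdSimplex ℝ (Fin M)).uniformContinuousOn_of_continuous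
    (continuousOn_infCost hS μ)
  rw [Metric.uniformContinuousOn_iff] at huc
  have hev : ∀ ε > 0, ∀ᶠ t : ℕ in atTop,
      dist (infCost (Alt C μ) (fun m => (pulls A t m : ℝ) / t) (empMean x A t)) v < ε := by
    intro ε hε
    obtain ⟨η, hη, hcont⟩ := huc (ε / 3) (by positivity)
    filter_upwards [(Metric.tendsto_nhds.1 h.tendsto_pulls_sub_wSum) η hη,
      (Metric.tendsto_nhds.1 hw) (ε / 3) (by positivity),
      hmean.eventually (eventually_abs_infCost_sub_le hS μ (show 0 < ε / 3 by positivity)),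
      eventually_ge_atTop 1] with t h₁ h₂ h₃ ht
    rw [dist_zero_right, ← dist_eq_norm] at h₁
    have hp := pulls_div_mem_stdSimplex A ht
    have h₄ := hcont _ hp _ (h.wSum_div_mem_stdSimplex ht) h₁
    have h₅ := h₃ _ hp
    rw [← Real.dist_eq] at h₅
    have h₆ := dist_triangle4 (infCost (Alt C μ) (fun m => (pulls A t m : ℝ) / t) (empMean x A t))
      (infCost (Alt C μ) (fun m => (pulls A t m : ℝ) / t) μ)
      (infCost (Alt C μ) (fun m => wSum w t m / t) μ) v
    linarith
  exact Metric.tendsto_nhds.2 hev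

/-- Applied at `t = ⌊b log(1/δ)⌋`, for which `b log(1/δ) < t + 1`. The hypothesis is uniform in `δ`
because `t` itself depends on `δ`. -/
lemma limsup_stopTime_le_of_eventually {b : ℝ} (hb : 0 < b)
    (h : ∀ᶠ t : ℕ in atTop, ∀ δ : ℝ, 0 < δ → Real.log (1 / δ) < (t + 1) / b →
      ENNReal.ofReal (threshold d A δ t) ≤ glrStat C x A t) :
    limsup (fun δ : ℝ => ((stopTime C x A δ : ℕ∞) : ℝ≥0∞) / ENNReal.ofReal (Real.log (1 / δ)))
      (𝓝[>] (0 : ℝ)) ≤ ENNReal.ofReal b := by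
  have hfloor : Tendsto (fun δ : ℝ => ⌊b * Real.log (1 / δ)⌋₊) (𝓝[>] 0) atTop :=
    tendsto_nat_floor_atTop.comp (tendsto_log_one_div.const_mul_atTop hb)
  refine limsup_le_of_le (by isBoundedDefault) ?_
  filter_upwards [hfloor.eventually h, hfloor.eventually_ge_atTop 1,
    tendsto_log_one_div.eventually_gt_atTop 0, self_mem_nhdsWithin] with δ h₁ h₂ hL hδ
  set t := ⌊b * Real.log (1 / δ)⌋₊
  have hle : stopTime C x A δ ≤ t := stopTime_le h₂ (h₁ δ hδ (by
    rw [lt_div_iff₀' hb]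
    exact Nat.lt_floor_add_one _))
  refine ENNReal.div_le_of_le_mul ?_
  rw [← ENNReal.ofReal_mul hb.le]
  calc ((stopTime C x A δ : ℕ∞) : ℝ≥0∞) ≤ ((t : ℕ∞) : ℝ≥0∞) := by
        exact_mod_cast hle
    _ = ENNReal.ofReal (t : ℝ) := by simp
    _ ≤ _ := ENNReal.ofReal_le_ofReal (Nat.floor_le (by positivity))

lemma limsup_stopTime_of_Alt_eq_empty (hS : ∀ ν, Alt C ν = ∅) :
    limsup (fun δ : ℝ => ((stopTime C x A δ : ℕ∞) : ℝ≥0∞) / ENNReal.ofReal (Real.log (1 / δ)))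
      (𝓝[>] (0 : ℝ)) = 0 := by
  refine le_antisymm (le_of_forall_gt_imp_ge_of_dense fun b hb => ?_) zero_le
  rcases eq_or_ne b ⊤ with rfl | hbt
  · exact le_top
  lift b to NNReal using hbt
  rw [← ENNReal.ofReal_coe_nnreal]
  refine limsup_stopTime_le_of_eventually (by simpa using hb) ?_
  filter_upwards [eventually_ge_atTop 1] with t ht δ _ _
  have : glrStat C x A t = ⊤ := by
    -- Needed because `0 * ⊤ = 0` in `ℝ≥0∞`.
    have ht' : (t : ℝ≥0∞) ≠ 0 := by simp; omega
    simp [glrStat, psi, hS, ENNReal.mul_top ht']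
  simp [this]

/-- If the rescaled statistic `Z(t) / t` converges to `v`, then the stopping time is at most
`(2 / v + o(1)) log (1 / δ)`. -/
lemma limsup_stopTime_le_of_tendsto {v : ℝ} (hv : 0 ≤ v)
    {g : ℕ → ℝ} (hg : Tendsto g atTop (𝓝 v))
    (hZ : ∀ᶠ t : ℕ in atTop, glrStat C x A t = t * ENNReal.ofReal (g t)) :
    limsup (fun δ : ℝ => ((stopTime C x A δ : ℕ∞) : ℝ≥0∞) / ENNReal.ofReal (Real.log (1 / δ)))
      (𝓝[>] (0 : ℝ)) ≤ 2 * (ENNReal.ofReal v)⁻¹ := by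
  -- For `v = 0` the bound is `⊤`.
  rcases hv.eq_or_lt with rfl | hv
  · simp
  rw [← ENNReal.ofReal_inv_of_pos hv, show (2 : ℝ≥0∞) = ENNReal.ofReal 2 by simp,
    ← ENNReal.ofReal_mul zero_le_two]
  refine le_of_forall_gt_imp_ge_of_dense fun b hb => ?_
  rcases eq_or_ne b ⊤ with rfl | hbt
  · exact le_top
  lift b to NNReal using hbt
  rw [← ENNReal.ofReal_coe_nnreal] at hb ⊢
  have hb0 : (0 : ℝ) < b := (ENNReal.ofReal_lt_ofReal_iff'.1 hb).2
  have hvb : 2 / (b : ℝ) < v := by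
    have := (ENNReal.ofReal_lt_ofReal_iff'.1 hb).1
    rw [← div_eq_mul_inv, div_lt_iff₀ hv] at this
    rwa [div_lt_iff₀' hb0]
  refine limsup_stopTime_le_of_eventually hb0 ?_
  -- This is the threshold bound divided by `t`, with `log(1/δ)` replaced by its largest admissible
  -- value `(t + 1) / b`.
  have hlim : Tendsto (fun t : ℕ => 2 / (b : ℝ) * (1 + (t : ℝ)⁻¹)
      + M * d * Real.log ((t : ℝ) + 1) / t) atTop (𝓝 (2 / b)) := by
    have := ((tendsto_inv_atTop_nhds_zero_nat (𝕜 := ℝ)).const_add 1).const_mul (2 / (b : ℝ))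
    simpa using this.add (tendsto_log_add_one_div (M * d))
  filter_upwards [hZ, hlim.eventually_lt hg hvb, eventually_ge_atTop 1] with t h₁ h₂ ht δ hδ hL
  have ht' : (0 : ℝ) < t := by exact_mod_cast ht
  rw [h₁, ← ENNReal.ofReal_natCast, ← ENNReal.ofReal_mul ht'.le]
  refine ENNReal.ofReal_le_ofReal ((threshold_le A hδ t).trans ?_)
  have h₃ := mul_lt_mul_of_pos_left h₂ ht'
  have h₄ : (t : ℝ) * (2 / (b : ℝ) * (1 + (t : ℝ)⁻¹) + M * d * Real.log ((t : ℝ) + 1) / t)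
      = 2 * ((t + 1) / b) + M * d * Real.log (t + 1) := by
    field_simp
  linarith

/-- The asymptotic bound holds on every run for which the sample means of each arm converge. -/
theorem IsATBOCRun.limsup_stopTime_le (h : IsATBOCRun C x A w) (hC : IsSlinkMap C)
    (hμ : dIntra μ (C μ) < dInter μ (C μ))
    (hx : ∀ m, Tendsto (fun n : ℕ => (n : ℝ)⁻¹ • ∑ i ∈ Finset.range n, x m i) atTop (𝓝 (μ m))) :
    limsup (fun δ : ℝ => ((stopTime C x A δ : ℕ∞) : ℝ≥0∞) / ENNReal.ofReal (Real.log (1 / δ)))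
      (𝓝[>] (0 : ℝ)) ≤ 2 * Tstar C μ := by
  rcases (Alt C μ).eq_empty_or_nonempty with hS | hS
  -- Without alternatives every instance is clustered like `μ`, so no closeness to `μ` is needed.
  · have hall : ∀ ν, Alt C ν = ∅ := fun ν =>
      hS ▸ Alt_eq_of_clusterEquiv (not_not.1 (Set.eq_empty_iff_forall_notMem.1 hS ν))
    rw [limsup_stopTime_of_Alt_eq_empty hall]
    exact zero_le
  have hmean := h.tendsto_empMean hx
  have hAlt := hmean.eventually (eventually_Alt_eq hC hμ)
  obtain ⟨u, hu, hmax⟩ := (isCompact_stdSimplex ℝ (Fin M)).exists_isMaxOn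
    ⟨_, h.mem_stdSimplex le_rfl⟩ (continuousOn_infCost hS μ)
  replace hmax : ∀ v ∈ stdSimplex ℝ (Fin M), infCost (Alt C μ) v μ ≤ infCost (Alt C μ) u μ :=
    isMaxOn_iff.1 hmax
  have hT : Tstar C μ = (ENNReal.ofReal (infCost (Alt C μ) u μ))⁻¹ := by
    rw [Tstar]
    congr 1
    refine le_antisymm (iSup₂_le fun v hv => ?_) (le_iSup₂_of_le u hu ?_)
    · rw [psi_eq_ofReal_infCost C hS]
      exact ENNReal.ofReal_le_ofReal (hmax v hv)
    · rw [psi_eq_ofReal_infCost C hS]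
  rw [hT]
  refine limsup_stopTime_le_of_tendsto (infCost_nonneg (nonneg_of_mem_stdSimplex hu) μ)
    (h.tendsto_infCost_pulls hS hmean (h.tendsto_infCost_wSum hS hmax
      (h.tendsto_infCost_plugIn hS hAlt hmean hu hmax))) ?_
  filter_upwards [hAlt] with t ht
  rw [glrStat, psi_eq_ofReal_infCost C (ht ▸ hS), ht]

end Run

/-- The strong law of large numbers for independent Gaussian samples. -/
lemma ae_tendsto_sampleMean (μ : Means d M) {Ω : Type*} [MeasurableSpace Ω] (P : Measure Ω)
    (X : Fin M → ℕ → Ω → EuclideanSpace ℝ (Fin d))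
    (hlaw : ∀ m i, HasLaw (X m i) (multivariateGaussian (μ m) 1) P)
    (hindep : iIndepFun (fun p : Fin M × ℕ => X p.1 p.2) P) :
    ∀ᵐ ω ∂P, ∀ m, Tendsto (fun n : ℕ => (n : ℝ)⁻¹ • ∑ i ∈ Finset.range n, X m i ω)
      atTop (𝓝 (μ m)) := by
  refine ae_all_iff.2 fun m => ?_
  have hint : Integrable (X m 0) P := by
    have : Integrable id (P.map (X m 0)) := (hlaw m 0).map_eq ▸ IsGaussian.integrable_id
    exact this.comp_aemeasurable (hlaw m 0).aemeasurable
  have hmean : ∫ ω, X m 0 ω ∂P = μ m := by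
    rw [(hlaw m 0).integral_eq, integral_id_multivariateGaussian]
  have hlln := strong_law_ae (μ := P) (X m) hint
    (fun i j hij => hindep.indepFun (i := (m, i)) (j := (m, j)) (by simpa using hij))
    (fun i => (hlaw m i).identDistrib (hlaw m 0))
  rwa [hmean] at hlln

end BanditClustering

end

theorem theorem3 {d M K : ℕ} (hK : 1 ≤ K) (hKM : K ≤ M)
    (C : BanditClustering.Means d M → Fin M → Fin K) (hC : BanditClustering.IsSlinkMap C)
    (μ : BanditClustering.Means d M)
    (hμ : BanditClustering.dIntra μ (C μ) < BanditClustering.dInter μ (C μ))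
    {Ω : Type*} [MeasurableSpace Ω] (P : Measure Ω) [IsProbabilityMeasure P]
    (X : Fin M → ℕ → Ω → EuclideanSpace ℝ (Fin d))
    (hlaw : ∀ m i, HasLaw (X m i) (multivariateGaussian (μ m) 1) P)
    (hindep : iIndepFun (fun p : Fin M × ℕ => X p.1 p.2) P)
    (A : ℕ → Ω → Fin M) (w : ℕ → Ω → Fin M → ℝ)
    (hrun : ∀ᵐ ω ∂P, BanditClustering.IsATBOCRun C (fun m i => X m i ω)
      (fun t => A t ω) (fun t => w t ω)) :
    ∀ᵐ ω ∂P,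
      limsup (fun δ : ℝ =>
          ((BanditClustering.stopTime C (fun m i => X m i ω) (fun t => A t ω) δ : ℕ∞) : ℝ≥0∞) /
            ENNReal.ofReal (Real.log (1 / δ)))
        (𝓝[>] (0 : ℝ)) ≤ 2 * BanditClustering.Tstar C μ := by
  filter_upwards [hrun, BanditClustering.ae_tendsto_sampleMean μ P X hlaw hindep] with ω hω hx
  exact hω.limsup_stopTime_le hC hμ hx
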